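/- Let $C$ be an algebraically closed field of characteristic zero, $R=C[[t]]$, $R((x))=R[[x]][x^{-1}]$, and $\vartheta(\sum a_nx^n)=\sum na_nx^n$. A connection over $R((x))$ is a pair $(E,\nabla)$ of a finite $R((x))$-module $E$ and an $R$-linear map $\nabla:E\to E$ with $\nabla(fe)=\vartheta(f)e+f\nabla(e)$. It is regular singular if it is isomorphic to $R((x))\otimes_{R[[x]]}\mathcal E$, with connection $f\otimes m\mapsto\vartheta(f)\otimes m+f\otimes\nabla_{\mathcal E}(m)$, for some finite $R[[x]]$-module $\mathcal E$ with a logarithmic connection, i.e. an $R$-linear map $\nabla_{\mathcal E}:\mathcal E\to\mathcal E$ such that $\nabla_{\mathcal E}(fm)=\vartheta(f)m+f\nabla_{\mathcal E}(m)$ for $f\in R[[x]]$. For $n\ge 0$, $J^\flat_n(f)$ denotes any $n\times n$ matrix with diagonal entries $f$, first subdiagonal entries in $\{0,1\}$ (not necessarily equal to each other), and all other entries $0$. The matrix of a map $D$ in a basis $(e_j)$ is the matrix $(M_{ij})$ with $D(e_j)=\sum_iM_{ij}e_i$. Characters are elements of $R((x))/(\mathbb Z+xR[[x]])\cong R[x^{-1}]/\mathbb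 Z$, a group which contains $R/\mathbb Z$. A TLJ-decomposition of $(E,\nabla)$ over $R((x))$ is a decomposition $E=\bigoplus_{\varphi\in\Phi}E_\varphi$, with $\Phi$ a finite set of characters, into nonzero $\nabla$-stable submodules such that for each $\varphi$ there is a representative $f\in R((x))$ of $\varphi$ for which $E_\varphi$ is the $R((x))$-span of $\ker(\nabla-f)^q$ for all large $q$. It is equipped with a TLJ-form if each $E_\varphi$ has an $R((x))$-basis in which the matrix of $\nabla$ is a $J^\flat_{r_\varphi}(f_\varphi)$ with $f_\varphi\in R((x))$ a representative of $\varphi$. $(E,\nabla)$ admits a TLJ-form over $R((x))$ if it has such a decomposition. **Theorem (Logarithmic decomposition).** Let $(E,\nabla)$ be a connection over $R((x))$ without $R$-torsion which admits a TLJ-form over $R((x))$. Then there is a unique decomposition $\nabla=\nabla^{\rm rs}+P_\nabla$, with $\nabla^{\rm rs}$ a connection on $E$ and $P_\nabla\in\mathrm{End}_{R((x))}(E)$, such that: (i) $(E,\nabla^{\rm rs})$ is regular singular and admits a TLJ-form over $R((x))$. (ii) $P_\nabla$ is diagonalizable (in an $R((x))$-basis of $E$), with all eigenvalues in $x^{-1}R[x^{-1}]$.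 (iii) For every TLJ-decomposition $E=\bigoplus_{\varrho\in\Sigma}E_\varrho$ of $(E,\nabla^{\rm rs})$ equipped with a TLJ-form, and every $\varrho\in\Sigma$: (a) $P_\nabla(E_\varrho)\subset E_\varrho$; (b) there are $c_\varrho\in R$ representing $\varrho$ (so $\Sigma\subset R/\mathbb Z$), integers $r_1,\dots,r_\ell\ge1$, elements $f_1,\dots,f_\ell\in x^{-1}R[x^{-1}]$, and an $R((x))$-basis of $E_\varrho$ in which the matrices of $\nabla^{\rm rs}$, $\nabla$ and $P_\nabla$ on $E_\varrho$ are respectively $$J^\flat_{r_1+\dots+r_\ell}(c_\varrho),\qquad \mathrm{diag}\big(J^\flat_{r_1}(c_\varrho+f_1),\dots,J^\flat_{r_\ell}(c_\varrho+f_\ell)\big),\qquad \mathrm{diag}\big(f_1I_{r_1},\dots,f_\ell I_{r_\ell}\big)$$ (equivalently, the matrices of $\nabla^{\rm rs}$ and $\nabla$ have the same subdiagonal entries). -/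

import Mathlib

open scoped LaurentSeries PowerSeries TensorProduct

noncomputable section

namespace LogDecomp

universe u v

section Base

variable (R : Type u) [CommRing R]

/-- The derivation `x d/dx` of `R((x))`, sending `∑ aₙ xⁿ` to `∑ n aₙ xⁿ`. -/
def theta (f : R⸨X⸩) : R⸨X⸩ where
  coeff n := (n : R) * f.coeff n
  isPWO_support' := f.isPWO_support.mono fun n hn h => hn (by
    show (n : R) * f.coeff n = 0
    rw [h, mul_zero])

/-- The same derivation on `R[[x]]`. -/
def thetaPow (f : R⟦X⟧) : R⟦X⟧ := PowerSeries.mk fun n => (n : R) * PowerSeries.coeff n f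

/-- The additive group `ℤ + x R[[x]]` of logarithmic derivatives in `R((x))`. -/
def dLog : AddSubgroup R⸨X⸩ where
  carrier := {f | (∀ n : ℤ, n < 0 → f.coeff n = 0) ∧ ∃ k : ℤ, f.coeff 0 = (k : R)}
  zero_mem' := ⟨fun _ _ => rfl, 0, by simp⟩
  add_mem' := by
    rintro f g ⟨hf, k, hk⟩ ⟨hg, l, hl⟩
    exact ⟨fun n hn => by simp [hf n hn, hg n hn], k + l, by simp [hk, hl]⟩
  neg_mem' := by
    rintro f ⟨hf, k, hk⟩
    exact ⟨fun n hn => by simp [hf n hn], -k, by simp [hk]⟩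

/-- The group of characters `R((x)) / (ℤ + x R[[x]])`. Every class contains an element of
`R[x⁻¹]`, unique up to adding an integer, so this is `R[x⁻¹] / ℤ`; the classes of the constants
form the subgroup `R / ℤ`. -/
abbrev Character : Type u := R⸨X⸩ ⧸ dLog R

/-- The subset `x⁻¹ R[x⁻¹]` of `R((x))`. -/
def polar : Set R⸨X⸩ := {f | ∀ n : ℤ, 0 ≤ n → f.coeff n = 0}

end Base

section JordanForm

variable {A : Type*} [CommRing A]

/-- `M` is a lower triangular matrix with `f` on the diagonal, entries `0` or `1` on the first
subdiagonal, and `0` elsewhere. -/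
def IsJordanFlat {n : ℕ} (f : A) (M : Matrix (Fin n) (Fin n) A) : Prop :=
  (∀ i, M i i = f) ∧
  (∀ i j : Fin n, (i : ℕ) = j + 1 → M i j = 0 ∨ M i j = 1) ∧
  (∀ i j : Fin n, i ≠ j → (i : ℕ) ≠ j + 1 → M i j = 0)

/-- The block diagonal matrix `diag(M₁, …, M_ℓ)`, with the blocks in this order. -/
def blockDiag {l : ℕ} {r : Fin l → ℕ} (M : ∀ k, Matrix (Fin (r k)) (Fin (r k)) A) :
    Matrix (Fin (∑ k, r k)) (Fin (∑ k, r k)) A :=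
  Matrix.reindex finSigmaFinEquiv finSigmaFinEquiv (Matrix.blockDiagonal' M)

end JordanForm

section Connections

variable (R : Type u) [CommRing R]
variable (E : Type v) [AddCommGroup E] [Module R E] [Module R⸨X⸩ E] [IsScalarTower R R⸨X⸩ E]

/-- A connection on the `R((x))`-module `E`: an `R`-linear map `E → E` with Leibniz's rule with
respect to `x d/dx`. -/
structure Connection where
  toLinearMap : E →ₗ[R] E
  leibniz : ∀ (f : R⸨X⸩) (e : E),
    toLinearMap (f • e) = theta R f • e + f • toLinearMap e

variable {R E}

/-- The operator `∇ - f`. -/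
def Connection.shift (D : Connection R E) (f : R⸨X⸩) : E →ₗ[R] E where
  toFun e := D.toLinearMap e - f • e
  map_add' a b := by rw [map_add, smul_add]; abel
  map_smul' r a := by
    have h : ∀ e : E, r • e = HahnSeries.C r • e := fun e => by
      rw [← one_smul R⸨X⸩ e, ← smul_assoc, smul_smul, HahnSeries.C_mul_eq_smul]
    rw [map_smul, RingHom.id_apply, smul_sub, h a, h (f • a), smul_comm]

/-- `(E, ∇)` is regular singular: it is isomorphic to the connection
`f ⊗ m ↦ θ(f) ⊗ m + f ⊗ D m` on `R((x)) ⊗ 𝓔`, for some finite `R[[x]]`-module `𝓔` with a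
logarithmic connection `D`. (The `R`-linearity of `D` follows from additivity and Leibniz's rule,
since the derivation kills `R`.) -/
def Connection.IsRegularSingular (D : Connection R E) : Prop :=
  ∃ (L : Type v) (_ : AddCommGroup L) (_ : Module R⟦X⟧ L) (_ : Module.Finite R⟦X⟧ L)
    (DL : L →+ L) (iso : (R⸨X⸩ ⊗[R⟦X⟧] L) ≃ₗ[R⸨X⸩] E),
    (∀ (f : R⟦X⟧) (m : L), DL (f • m) = thetaPow R f • m + f • DL m) ∧
    ∀ (f : R⸨X⸩) (m : L),
      D.toLinearMap (iso (f ⊗ₜ[R⟦X⟧] m)) = iso (theta R f ⊗ₜ[R⟦X⟧] m + f ⊗ₜ[R⟦X⟧] DL m)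

/-- `M` is the matrix of `D` in the family `b`: `D bⱼ = ∑ᵢ Mᵢⱼ bᵢ`. -/
def HasMatrix {n : ℕ} (D : E → E) (b : Fin n → E) (M : Matrix (Fin n) (Fin n) R⸨X⸩) : Prop :=
  ∀ j, D (b j) = ∑ i, M i j • b i

/-- The family `W`, indexed by a finite set `Φ` of characters, is a
Turrittin-Levelt-Jordan decomposition of `(E, ∇)` over `R((x))`: `E` is the direct sum of the
nonzero `∇`-stable submodules `W φ`, and `W φ` is spanned by `ker (∇ - f)^q`, for a
representative `f` of `φ` and all large enough `q`. -/
structure IsTLJDecomposition (D : Connection R E) (Φ : Finset (Character R))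
    (W : Φ → Submodule R⸨X⸩ E) : Prop where
  independent : iSupIndep W
  spanning : ⨆ φ, W φ = ⊤
  ne_bot : ∀ φ, W φ ≠ ⊥
  stable : ∀ φ, ∀ e ∈ W φ, D.toLinearMap e ∈ W φ
  generated : ∀ φ : Φ, ∃ f : R⸨X⸩, (QuotientAddGroup.mk f : Character R) = φ ∧
    ∀ᶠ q : ℕ in Filter.atTop,
      W φ = Submodule.span R⸨X⸩ (LinearMap.ker (D.shift f ^ q) : Set E)

/-- `W` is a TLJ-decomposition equipped with a TLJ-form: each `W φ` has a basis in which the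
matrix of `∇` is of Jordan type with diagonal a representative of `φ`. -/
def IsTLJForm (D : Connection R E) (Φ : Finset (Character R))
    (W : Φ → Submodule R⸨X⸩ E) : Prop :=
  IsTLJDecomposition D Φ W ∧
  ∀ φ : Φ, ∃ (f : R⸨X⸩) (n : ℕ) (b : Module.Basis (Fin n) R⸨X⸩ (W φ))
    (J : Matrix (Fin n) (Fin n) R⸨X⸩),
    (QuotientAddGroup.mk f : Character R) = φ ∧ IsJordanFlat f J ∧
    HasMatrix D.toLinearMap (fun i => (b i : E)) J

/-- `(E, ∇)` admits a TLJ-form over `R((x))`. -/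
def Connection.AdmitsTLJForm (D : Connection R E) : Prop :=
  ∃ (Φ : Finset (Character R)) (W : Φ → Submodule R⸨X⸩ E), IsTLJForm D Φ W

/-- `P` is diagonal in some `R((x))`-basis of `E`. -/
def IsDiagonalizable (P : Module.End R⸨X⸩ E) : Prop :=
  ∃ (n : ℕ) (b : Module.Basis (Fin n) R⸨X⸩ E) (d : Fin n → R⸨X⸩), ∀ i, P (b i) = d i • b i

/-- The properties required of a component `W` of type `ϱ` of `(E, ∇ʳˢ)`, relative to `∇` and
`P`: `W` is `P`-stable, and has a basis in which `∇ʳˢ` has a constant Jordan type matrix, `∇` has a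
block diagonal matrix of Jordan type blocks, and `P` is the corresponding scalar on each block. -/
def CompatibleForm (D Drs : Connection R E) (P : Module.End R⸨X⸩ E) (ϱ : Character R)
    (W : Submodule R⸨X⸩ E) : Prop :=
  (∀ e ∈ W, P e ∈ W) ∧
  ∃ (c : R) (l : ℕ) (r : Fin l → ℕ) (f : Fin l → R⸨X⸩)
    (b : Module.Basis (Fin (∑ k, r k)) R⸨X⸩ W)
    (J : Matrix (Fin (∑ k, r k)) (Fin (∑ k, r k)) R⸨X⸩)
    (M : ∀ k, Matrix (Fin (r k)) (Fin (r k)) R⸨X⸩),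
    (QuotientAddGroup.mk (HahnSeries.C c) : Character R) = ϱ ∧
    (∀ k, 0 < r k) ∧ (∀ k, f k ∈ polar R) ∧
    IsJordanFlat (HahnSeries.C c) J ∧
    HasMatrix Drs.toLinearMap (fun i => (b i : E)) J ∧
    (∀ k, IsJordanFlat (HahnSeries.C c + f k) (M k)) ∧
    HasMatrix D.toLinearMap (fun i => (b i : E)) (blockDiag M) ∧
    HasMatrix P (fun i => (b i : E))
      (blockDiag fun k => f k • (1 : Matrix (Fin (r k)) (Fin (r k)) R⸨X⸩))

/-- `∇ = ∇ʳˢ + P` is a logarithmic decomposition. -/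
structure IsLogDecomposition (D Drs : Connection R E) (P : Module.End R⸨X⸩ E) : Prop where
  sum : ∀ e, D.toLinearMap e = Drs.toLinearMap e + P e
  regularSingular : Drs.IsRegularSingular
  admitsTLJForm : Drs.AdmitsTLJForm
  diagonalizable : IsDiagonalizable P
  eigenvalues : ∀ μ : R⸨X⸩, P.HasEigenvalue μ → μ ∈ polar R
  components : ∀ (Sig : Finset (Character R)) (W : Sig → Submodule R⸨X⸩ E),
    IsTLJForm Drs Sig W → ∀ ϱ : Sig, CompatibleForm D Drs P ϱ (W ϱ)

end Connections

end LogDecomp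

end

noncomputable section

namespace LogDecomp

-- Rescaling a basis vector by a unit `u` adds the logarithmic derivative `θ(u)/u` to the diagonal.
-- These logarithmic derivatives fill out `ℤ + x R[[x]]`, because nonzero integers are invertible in
-- `R` (`exists_unit_theta_eq`). So every Jordan block can be rescaled until its diagonal is `c +
-- p`, with `p` polar and `c` taken from a fixed system of representatives of `R/ℤ`
-- (`HasBlockMatrix.exists_rescale`). Letting `P` act on each such block as the scalar `p`, the
-- operator `∇ - P` has Jordan blocks with constant diagonal `c`. Its matrix therefore has entries
-- in `R[[x]]`, which gives regular singularity. Blocks with the same class in `R/ℤ` have literally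
-- the same `c`, so together they form a single `J♭`.
--
-- The rest is rigidity. A nonzero solution of `θ(v) + a v = 0` forces `a ∈ ℤ + x R[[x]]`
-- (`mem_dLog_of_theta_add_mul_eq_zero`), so blocks of another character contribute nothing to `ker
-- (∇ - f)^q`. Hence the span of this kernel for large `q` is the sum of the blocks with the
-- character of `f`, in whatever Jordan basis it is computed (`eventually_span_ker_shift_pow`). Two
-- consequences follow. Every TLJ-decomposition of `∇ - P` is the one read off from the adapted
-- basis (`IsTLJDecomposition.eq_span`), so condition (iii) need only be checked there. And a
-- character determines its polar part, so any two endomorphisms admitting adapted bases for the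
-- same `∇` agree (`IsAdapted.unique`). Condition (iii) supplies such a basis for any competing
-- decomposition (`IsLogDecomposition.exists_isAdapted`), whence uniqueness.

universe u v w

/-! ### The derivation `θ` and logarithmic derivatives of units. -/

section Theta

variable {R : Type u} [CommRing R]

@[simp]
theorem coeff_theta (f : R⸨X⸩) (n : ℤ) : (theta R f).coeff n = (n : R) * f.coeff n := rfl

theorem theta_add (f g : R⸨X⸩) : theta R (f + g) = theta R f + theta R g := by
  ext n; simp [mul_add]

theorem theta_C (c : R) : theta R (HahnSeries.C c) = 0 := by
  ext n
  rcases eq_or_ne n 0 with rfl | hn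
  · simp
  · simp [HahnSeries.C_apply, HahnSeries.coeff_single_of_ne hn]

theorem theta_one : theta R 1 = 0 := by
  simpa using theta_C (1 : R)

theorem theta_single (k : ℤ) (a : R) :
    theta R (HahnSeries.single k a) = HahnSeries.C (k : R) * HahnSeries.single k a := by
  ext n
  rw [HahnSeries.C_mul_eq_smul, HahnSeries.coeff_smul, coeff_theta, smul_eq_mul]
  rcases eq_or_ne n k with rfl | hn
  · rfl
  · simp [HahnSeries.coeff_single_of_ne hn]

theorem theta_mul (f g : R⸨X⸩) : theta R (f * g) = theta R f * g + f * theta R g := by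
  ext n
  -- `θ` can shrink supports, so both products on the right are summed over pairs from the supports
  -- of `f` and `g`; all three sums then share one index set.
  have hf : (theta R f).support ⊆ f.support := fun m hm h => hm (by
    simp [coeff_theta, h])
  have hg : (theta R g).support ⊆ g.support := fun m hm h => hm (by
    simp [coeff_theta, h])
  rw [coeff_theta, HahnSeries.coeff_add, HahnSeries.coeff_mul,
    HahnSeries.coeff_mul_left' f.isPWO_support hf, HahnSeries.coeff_mul_right' g.isPWO_support hg,
    ← Finset.sum_add_distrib, Finset.mul_sum]
  refine Finset.sum_congr rfl fun ij hij => ?_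
  have h : ij.1 + ij.2 = n := (Finset.mem_antidiagonal.1 hij).2.2
  simp only [coeff_theta, ← h]
  push_cast
  ring

theorem theta_ofPowerSeries (f : R⟦X⟧) :
    theta R (HahnSeries.ofPowerSeries ℤ R f) = HahnSeries.ofPowerSeries ℤ R (thetaPow R f) := by
  ext n
  rw [coeff_theta]
  rcases lt_or_ge n 0 with hn | hn
  · have h : ∀ g : R⟦X⟧, (HahnSeries.ofPowerSeries ℤ R g).coeff n = 0 := fun g => by
      rw [PowerSeries.coeff_coe, if_pos hn]
    rw [h, h, mul_zero]
  · lift n to ℕ using hn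
    simp [thetaPow]

/-- Up to sign, a logarithmic derivative of a nonzero series lies in `ℤ + x R[[x]]`. -/
theorem mem_dLog_of_theta_add_mul_eq_zero [IsDomain R] {a v : R⸨X⸩}
    (h : theta R v + a * v = 0) (hv : v ≠ 0) : a ∈ dLog R := by
  rcases eq_or_ne a 0 with rfl | ha
  · exact zero_mem _
  -- Coefficient of the equation in degree `ord a + ord v`, the lowest degree of `a v`. A pole of
  -- `a` would leave only the nonzero product of leading coefficients; if `ord a = 0`, it gives `a₀
  -- = -ord v`.
  have hlead : a.coeff a.order * v.coeff v.order + (a.order + v.order : ℤ) *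
      v.coeff (a.order + v.order) = 0 := by
    have := congrArg (fun s => HahnSeries.coeff s (a.order + v.order)) h
    simp only [HahnSeries.coeff_add, coeff_theta, HahnSeries.coeff_mul_order_add_order,
      HahnSeries.coeff_zero, HahnSeries.leadingCoeff_eq] at this
    rw [add_comm]; exact this
  have hv' : v.coeff v.order ≠ 0 := HahnSeries.coeff_order_eq_zero.not.2 hv
  have ha' : a.coeff a.order ≠ 0 := HahnSeries.coeff_order_eq_zero.not.2 ha
  have hord : 0 ≤ a.order := by
    by_contra! hneg
    have : v.coeff (a.order + v.order) = 0 :=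
      HahnSeries.coeff_eq_zero_of_lt_order (add_lt_of_neg_left _ hneg)
    rw [this, mul_zero, add_zero] at hlead
    exact mul_ne_zero ha' hv' hlead
  refine ⟨fun n hn => HahnSeries.coeff_eq_zero_of_lt_order (by omega), ?_⟩
  rcases hord.lt_or_eq with hpos | hzero
  · exact ⟨0, by rw [HahnSeries.coeff_eq_zero_of_lt_order hpos, Int.cast_zero]⟩
  · refine ⟨-v.order, ?_⟩
    rw [← hzero, zero_add, ← add_mul] at hlead
    rw [Int.cast_neg]
    exact eq_neg_of_add_eq_zero_left ((mul_eq_zero.1 hlead).resolve_right hv')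

/-- The coefficients of the solution of `x u' = f u` with constant term `1`, for
`f` without constant term. -/
def expCoeff (f : R⟦X⟧) : ℕ → R
  | 0 => 1
  | n + 1 => Ring.inverse ((n + 1 : ℕ) : R) *
      ∑ j : Fin (n + 1), PowerSeries.coeff (n + 1 - j) f * expCoeff f j

/-- The solution is formally `exp (∫ f dx/x)`. Comparing coefficients gives `n uₙ = ∑_{j<n} f_{n-j}
uⱼ`: since `f₀ = 0`, the right side does not involve `uₙ`, and division by `n` is allowed. -/
theorem exists_unit_thetaPow_eq (hR : ∀ n : ℕ, n ≠ 0 → IsUnit (n : R)) (f : R⟦X⟧)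
    (hf : PowerSeries.coeff 0 f = 0) : ∃ u : R⟦X⟧, IsUnit u ∧ thetaPow R u = f * u := by
  refine ⟨PowerSeries.mk (expCoeff f), ?_, ?_⟩
  · rw [PowerSeries.isUnit_iff_constantCoeff, ← PowerSeries.coeff_zero_eq_constantCoeff_apply,
      PowerSeries.coeff_mk, expCoeff]
    exact isUnit_one
  · ext n
    rw [thetaPow, PowerSeries.coeff_mk, PowerSeries.coeff_mk, mul_comm f, PowerSeries.coeff_mul,
      Finset.Nat.sum_antidiagonal_eq_sum_range_succ_mk, Finset.sum_range_succ]
    simp only [PowerSeries.coeff_mk, Nat.sub_self, hf, mul_zero, add_zero]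
    cases n with
    | zero => simp
    | succ n =>
      -- `Ring.inverse` takes the value `0` off the units; here `n + 1` is a unit, so it is a true
      -- inverse.
      rw [expCoeff, ← mul_assoc, Ring.mul_inverse_cancel _ (hR _ n.succ_ne_zero), one_mul,
        Finset.sum_range]
      exact Finset.sum_congr rfl fun j _ => mul_comm _ _

/-- Every element of `ℤ + x R[[x]]` is the logarithmic derivative of a unit. -/
theorem exists_unit_theta_eq (hR : ∀ n : ℕ, n ≠ 0 → IsUnit (n : R)) {f : R⸨X⸩}
    (hf : f ∈ dLog R) : ∃ u : R⸨X⸩ˣ, theta R u = f * u := by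
  obtain ⟨hneg, k, hk⟩ := hf
  -- Split `f` as `k` plus its positive part: `xᵏ` has logarithmic derivative `k`, the power series
  -- `u` accounts for the positive part, and logarithmic derivatives add under multiplication.
  obtain ⟨u, hu, hfu⟩ := exists_unit_thetaPow_eq hR
    (PowerSeries.mk fun n => if n = 0 then 0 else f.coeff n) (by simp)
  have hf : f = HahnSeries.C (k : R) + HahnSeries.ofPowerSeries ℤ R
      (PowerSeries.mk fun n => if n = 0 then 0 else f.coeff n) := by
    ext n
    rw [HahnSeries.coeff_add, PowerSeries.coeff_coe]
    rcases lt_trichotomy n 0 with hn | rfl | hn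
    · rw [if_pos hn, hneg n hn, add_zero, HahnSeries.C_apply,
        HahnSeries.coeff_single_of_ne hn.ne]
    · rw [if_neg (lt_irrefl _), HahnSeries.C_apply, HahnSeries.coeff_single_same, hk]
      simp
    · rw [if_neg hn.not_gt, HahnSeries.C_apply, HahnSeries.coeff_single_of_ne hn.ne', zero_add,
        PowerSeries.coeff_mk, if_neg (by omega), Int.natAbs_of_nonneg hn.le]
  have hx : (HahnSeries.single k (1 : R) : R⸨X⸩) * HahnSeries.single (-k) 1 = 1 := by
    rw [HahnSeries.single_mul_single, add_neg_cancel, mul_one]; rfl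
  let xk : R⸨X⸩ˣ := ⟨HahnSeries.single k 1, HahnSeries.single (-k) 1, hx, by rw [mul_comm, hx]⟩
  refine ⟨xk * Units.map (HahnSeries.ofPowerSeries ℤ R).toMonoidHom hu.unit, ?_⟩
  have hval : ((xk * Units.map (HahnSeries.ofPowerSeries ℤ R).toMonoidHom hu.unit : R⸨X⸩ˣ) :
      R⸨X⸩) = HahnSeries.single k 1 * HahnSeries.ofPowerSeries ℤ R u := rfl
  rw [hval, theta_mul, theta_single, theta_ofPowerSeries, hfu, map_mul]
  conv_rhs => rw [hf]
  ring

end Theta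

/-! ### Characters: polar parts and constant representatives. -/

section Characters

variable {R : Type u} [CommRing R]

theorem mk_eq_mk_iff {f g : R⸨X⸩} :
    (QuotientAddGroup.mk f : Character R) = QuotientAddGroup.mk g ↔ g - f ∈ dLog R := by
  rw [QuotientAddGroup.eq, neg_add_eq_sub]

/-- The part of a series with negative exponents. -/
def polarPart (f : R⸨X⸩) : R⸨X⸩ where
  coeff n := if n < 0 then f.coeff n else 0
  isPWO_support' := f.isPWO_support.mono fun n hn h => hn (by
    show (if n < 0 then f.coeff n else 0) = 0
    rw [h, ite_self])

theorem coeff_polarPart (f : R⸨X⸩) (n : ℤ) :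
    (polarPart f).coeff n = if n < 0 then f.coeff n else 0 := rfl

theorem polarPart_mem_polar (f : R⸨X⸩) : polarPart f ∈ polar R := fun n hn => by
  rw [coeff_polarPart, if_neg hn.not_gt]

theorem sub_C_add_polarPart_mem_dLog (f : R⸨X⸩) :
    f - (HahnSeries.C (f.coeff 0) + polarPart f) ∈ dLog R := by
  refine ⟨fun n hn => ?_, 0, ?_⟩
  · simp [coeff_polarPart, hn, HahnSeries.C_apply, HahnSeries.coeff_single_of_ne hn.ne]
  · simp [coeff_polarPart]

/-- The polar part is determined by the character. -/
theorem polar_eq_of_mk_eq {c d : R} {p q : R⸨X⸩} (hp : p ∈ polar R) (hq : q ∈ polar R)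
    (h : (QuotientAddGroup.mk (HahnSeries.C c + p) : Character R) =
      QuotientAddGroup.mk (HahnSeries.C d + q)) : p = q := by
  have h' := (mk_eq_mk_iff.1 h).1
  ext n
  rcases lt_or_ge n 0 with hn | hn
  · have := h' n hn
    simp only [HahnSeries.coeff_sub, HahnSeries.coeff_add, HahnSeries.C_apply,
      HahnSeries.coeff_single_of_ne hn.ne, zero_add] at this
    exact (sub_eq_zero.1 this).symm
  · rw [hp n hn, hq n hn]

/-- A system of representatives of `R / ℤ`. -/
theorem exists_constant_representatives (R : Type u) [CommRing R] : ∃ σ : R → R,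
    (∀ r, (QuotientAddGroup.mk (HahnSeries.C (σ r)) : Character R) =
      QuotientAddGroup.mk (HahnSeries.C r)) ∧
    ∀ r s, (QuotientAddGroup.mk (HahnSeries.C (σ r)) : Character R) =
      QuotientAddGroup.mk (HahnSeries.C (σ s)) → σ r = σ s := by
  let F : R → Character R := fun r => QuotientAddGroup.mk (HahnSeries.C r)
  have hF : ∀ r, F (Function.invFun F (F r)) = F r := fun r => Function.invFun_eq ⟨r, rfl⟩
  refine ⟨fun r => Function.invFun F (F r), hF, fun r s h => ?_⟩
  have : F r = F s := (hF r).symm.trans (h.trans (hF s))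
  simp only [this]

end Characters

/-! ### Generalized kernels of `∇ - f` in a basis of Jordan blocks. -/

section Blocks

variable {R : Type u} [CommRing R]
variable {E : Type v} [AddCommGroup E] [Module R E] [Module R⸨X⸩ E]
variable {κ : Type w} {n : κ → ℕ}

/-- `D` has the block diagonal matrix with blocks `M k` in the family `B`. -/
def HasBlockMatrix (D : E → E) (B : (Σ k, Fin (n k)) → E)
    (M : ∀ k, Matrix (Fin (n k)) (Fin (n k)) R⸨X⸩) : Prop :=
  ∀ k i, D (B ⟨k, i⟩) = ∑ j, M k j i • B ⟨k, j⟩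

theorem Connection.ext' {D D' : Connection R E} (h : ∀ e, D.toLinearMap e = D'.toLinearMap e) :
    D = D' := by
  obtain ⟨L, _⟩ := D
  obtain ⟨L', _⟩ := D'
  obtain rfl : L = L' := LinearMap.ext h
  rfl

/-- The column form of the Jordan condition: an operator with this matrix, minus `g`, sends each
basis vector to `0` or to the next one. This is the source of nilpotency below. -/
theorem sum_jordanFlat_smul {A V : Type*} [CommRing A] [AddCommGroup V] [Module A V]
    {m : ℕ} {g : A} {M : Matrix (Fin m) (Fin m) A} (hM : IsJordanFlat g M)
    (b : Fin m → V) (i : Fin m) :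
    ∑ j, M j i • b j = g • b i ∨
      ∃ j : Fin m, (j : ℕ) = i + 1 ∧ ∑ j, M j i • b j = g • b i + b j := by
  by_cases h : ∃ j : Fin m, (j : ℕ) = i + 1 ∧ M j i = 1
  · obtain ⟨j, hj, hji⟩ := h
    refine Or.inr ⟨j, hj, ?_⟩
    have hne : i ≠ j := fun h => by subst h; omega
    rw [← Finset.sum_subset (Finset.subset_univ {i, j}), Finset.sum_pair hne, hM.1, hji, one_smul]
    intro k _ hk
    simp only [Finset.mem_insert, Finset.mem_singleton, not_or] at hk
    rw [hM.2.2 k i hk.1 fun h => hk.2 (Fin.ext (by omega)), zero_smul]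
  · left
    rw [Finset.sum_eq_single i, hM.1]
    · intro j _ hji
      by_cases hj : (j : ℕ) = i + 1
      · rw [(hM.2.1 j i hj).resolve_right fun h' => h ⟨j, hj, h'⟩, zero_smul]
      · rw [hM.2.2 j i hji hj, zero_smul]
    · simp

variable (D : Connection R E)

/-- In coordinates `∇` is `v ↦ θ(v) + M v`, one block at a time; this turns questions about kernels
into scalar differential equations. -/
theorem repr_connection [Fintype κ] (B : Module.Basis (Σ k, Fin (n k)) R⸨X⸩ E)
    {M : ∀ k, Matrix (Fin (n k)) (Fin (n k)) R⸨X⸩} (hB : HasBlockMatrix D.toLinearMap B M)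
    (e : E) (k : κ) (i : Fin (n k)) :
    B.repr (D.toLinearMap e) ⟨k, i⟩ =
      theta R (B.repr e ⟨k, i⟩) + ∑ j, M k i j * B.repr e ⟨k, j⟩ := by
  classical
  have hDe : D.toLinearMap e = ∑ x, (theta R (B.repr e x) • B x +
      B.repr e x • D.toLinearMap (B x)) := by
    conv_lhs => rw [← B.sum_repr e, map_sum]
    exact Finset.sum_congr rfl fun x _ => D.leibniz _ _
  rw [hDe, Finset.sum_add_distrib, map_add, Finsupp.add_apply, B.repr_sum_self]
  congr 1
  rw [map_sum, Finsupp.finsetSum_apply, Fintype.sum_sigma, Finset.sum_eq_single k]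
  · refine Finset.sum_congr rfl fun j _ => ?_
    rw [hB, map_smul, map_sum, Finsupp.smul_apply, Finsupp.finsetSum_apply,
      Finset.sum_eq_single i, map_smul, Finsupp.smul_apply, B.repr_self, Finsupp.single_eq_same,
      smul_eq_mul, smul_eq_mul, mul_one, mul_comm]
    · intro l _ hl
      rw [map_smul, Finsupp.smul_apply, B.repr_self, Finsupp.single_eq_of_ne, smul_zero]
      intro h
      exact hl (eq_of_heq (Sigma.mk.inj h).2).symm
    · simp
  · intro k' _ hk
    refine Finset.sum_eq_zero fun j _ => ?_
    rw [hB, map_smul, map_sum, Finsupp.smul_apply, Finsupp.finsetSum_apply, Finset.sum_eq_zero,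
      smul_zero]
    intro l _
    rw [map_smul, Finsupp.smul_apply, B.repr_self, Finsupp.single_eq_of_ne, smul_zero]
    intro h
    exact hk (Sigma.mk.inj h).1.symm
  · simp

variable [IsScalarTower R R⸨X⸩ E]

theorem Connection.shift_apply (f : R⸨X⸩) (e : E) :
    D.shift f e = D.toLinearMap e - f • e := rfl

/-- The block is lower bidiagonal, so row `i` involves only coordinates `i` and `i - 1`. Once the
earlier coordinates vanish, coordinate `i` satisfies `θ(v) + (g k - f) v = 0`, and a nonzero
solution would make the two characters equal. -/
theorem repr_eq_zero_of_shift [IsDomain R] [Fintype κ]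
    (B : Module.Basis (Σ k, Fin (n k)) R⸨X⸩ E) {g : κ → R⸨X⸩}
    {M : ∀ k, Matrix (Fin (n k)) (Fin (n k)) R⸨X⸩} (hM : ∀ k, IsJordanFlat (g k) (M k))
    (hB : HasBlockMatrix D.toLinearMap B M) (f : R⸨X⸩) (k : κ)
    (hk : (QuotientAddGroup.mk (g k) : Character R) ≠ QuotientAddGroup.mk f) (e : E)
    (he : ∀ i, B.repr (D.shift f e) ⟨k, i⟩ = 0) (i : Fin (n k)) : B.repr e ⟨k, i⟩ = 0 := by
  obtain ⟨i, hi⟩ := i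
  induction i using Nat.strong_induction_on with
  | _ i ih =>
    have h := he ⟨i, hi⟩
    rw [D.shift_apply, map_sub, map_smul, Finsupp.sub_apply, Finsupp.smul_apply,
      repr_connection D B hB, Finset.sum_eq_single ⟨i, hi⟩, (hM k).1, smul_eq_mul,
      add_sub_assoc, ← sub_mul] at h
    · by_contra hne
      refine hk (mk_eq_mk_iff.2 ?_)
      rw [← neg_sub]
      exact neg_mem (mem_dLog_of_theta_add_mul_eq_zero h hne)
    · intro j _ hj
      by_cases hij : i = j + 1
      · rw [ih j (by omega) j.2, mul_zero]
      · rw [(hM k).2.2 _ _ hj.symm hij, zero_mul]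
    · simp

theorem ker_shift_pow_le [IsDomain R] [Fintype κ]
    (B : Module.Basis (Σ k, Fin (n k)) R⸨X⸩ E) {g : κ → R⸨X⸩}
    {M : ∀ k, Matrix (Fin (n k)) (Fin (n k)) R⸨X⸩} (hM : ∀ k, IsJordanFlat (g k) (M k))
    (hB : HasBlockMatrix D.toLinearMap B M) (f : R⸨X⸩) (q : ℕ) (e : E)
    (he : (D.shift f ^ q) e = 0) (k : κ)
    (hk : (QuotientAddGroup.mk (g k) : Character R) ≠ QuotientAddGroup.mk f)
    (i : Fin (n k)) : B.repr e ⟨k, i⟩ = 0 := by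
  induction q generalizing e i with
  | zero =>
    rw [pow_zero, Module.End.one_apply] at he
    rw [he, map_zero, Finsupp.zero_apply]
  | succ q ih =>
    rw [pow_succ, Module.End.mul_apply] at he
    exact repr_eq_zero_of_shift D B hM hB f k hk e (fun i => ih _ he i) i

/-- Multiplication by `u` intertwines `∇ - g k` with `∇ - f`, and `∇ - g k` moves each basis vector
of the block one step down or kills it. Starting at position `i`, the end of the block is passed
after `n k - i` steps. -/
theorem shift_pow_unit_smul (B : (Σ k, Fin (n k)) → E) {g : κ → R⸨X⸩}
    {M : ∀ k, Matrix (Fin (n k)) (Fin (n k)) R⸨X⸩} (hM : ∀ k, IsJordanFlat (g k) (M k))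
    (hB : HasBlockMatrix D.toLinearMap B M) (f : R⸨X⸩) (k : κ) (u : R⸨X⸩)
    (hu : theta R u = (f - g k) * u) (q : ℕ) (i : Fin (n k)) (hq : n k ≤ i + q) :
    (D.shift f ^ q) (u • B ⟨k, i⟩) = 0 := by
  induction q generalizing i with
  | zero => exact absurd i.2 (by omega)
  | succ q ih =>
    have key : D.shift f (u • B ⟨k, i⟩) =
        u • (∑ j, M k j i • B ⟨k, j⟩ - g k • B ⟨k, i⟩) := by
      rw [D.shift_apply, D.leibniz, hu, hB k i]
      rw [sub_mul, sub_smul, smul_sub, mul_smul, mul_smul, smul_comm u (g k)]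
      abel
    rw [pow_succ, Module.End.mul_apply, key]
    rcases sum_jordanFlat_smul (hM k) (fun j => B ⟨k, j⟩) i with h | ⟨j, hj, h⟩
    · rw [h, sub_self, smul_zero, map_zero]
    · rw [h, add_sub_cancel_left]
      exact ih j (by omega)

/-- The generalized kernels of `∇ - f` span the sum of the Jordan blocks with character `f`. -/
theorem eventually_span_ker_shift_pow [IsDomain R] [Fintype κ]
    (hR : ∀ n : ℕ, n ≠ 0 → IsUnit (n : R))
    (B : Module.Basis (Σ k, Fin (n k)) R⸨X⸩ E) {g : κ → R⸨X⸩}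
    {M : ∀ k, Matrix (Fin (n k)) (Fin (n k)) R⸨X⸩} (hM : ∀ k, IsJordanFlat (g k) (M k))
    (hB : HasBlockMatrix D.toLinearMap B M) (f : R⸨X⸩) :
    ∀ᶠ q : ℕ in Filter.atTop,
      Submodule.span R⸨X⸩ (LinearMap.ker (D.shift f ^ q) : Set E) =
        Submodule.span R⸨X⸩
          (B '' {x | (QuotientAddGroup.mk (g x.1) : Character R) = QuotientAddGroup.mk f}) := by
  -- Any bound at least the size of every block would do; the total rank is one.
  filter_upwards [Filter.eventually_ge_atTop (∑ k, n k)] with q hq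
  apply le_antisymm
  · rw [Submodule.span_le]
    intro e he
    rw [SetLike.mem_coe, B.mem_span_image]
    rintro ⟨k, i⟩ hx
    by_contra hk
    exact Finsupp.mem_support_iff.1 hx (ker_shift_pow_le D B hM hB f q e he k hk i)
  · rw [Submodule.span_le]
    rintro _ ⟨⟨k, i⟩, hk, rfl⟩
    obtain ⟨u, hu⟩ := exists_unit_theta_eq hR (mk_eq_mk_iff.1 hk)
    have hmem : (u : R⸨X⸩) • B ⟨k, i⟩ ∈
        Submodule.span R⸨X⸩ (LinearMap.ker (D.shift f ^ q) : Set E) := by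
      refine Submodule.subset_span (shift_pow_unit_smul D B hM hB f k u hu q i ?_)
      have := Finset.single_le_sum (f := n) (fun _ _ => Nat.zero_le _) (Finset.mem_univ k)
      omega
    have := Submodule.smul_mem _ ((u⁻¹ : R⸨X⸩ˣ) : R⸨X⸩) hmem
    rwa [smul_smul, Units.inv_mul, one_smul] at this

/-- Both descriptions of the span of the generalized kernel hold for large `q`, so they can be
compared at a common `q`. Thus the component of a given character does not depend on the
decomposition. -/
theorem IsTLJDecomposition.eq_span [IsDomain R] [Fintype κ]
    (hR : ∀ n : ℕ, n ≠ 0 → IsUnit (n : R)) {D : Connection R E}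
    {Φ : Finset (Character R)} {W : Φ → Submodule R⸨X⸩ E} (hW : IsTLJDecomposition D Φ W)
    (B : Module.Basis (Σ k, Fin (n k)) R⸨X⸩ E) {g : κ → R⸨X⸩}
    {M : ∀ k, Matrix (Fin (n k)) (Fin (n k)) R⸨X⸩} (hM : ∀ k, IsJordanFlat (g k) (M k))
    (hB : HasBlockMatrix D.toLinearMap B M) (φ : Φ) :
    W φ = Submodule.span R⸨X⸩
      (B '' {x | (QuotientAddGroup.mk (g x.1) : Character R) = φ}) := by
  obtain ⟨f, hf, h⟩ := hW.generated φ
  obtain ⟨q, h₁, h₂⟩ := (h.and (eventually_span_ker_shift_pow D hR B hM hB f)).exists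
  rw [h₁, h₂, hf]

/-- The basis `B` is adapted to `D` and `P`: it consists of Jordan blocks with diagonal `c + p`, where `c` is
constant, `p` is polar, and `P` acts on the block as `p`. -/
structure IsAdapted (D : Connection R E) (P : Module.End R⸨X⸩ E)
    (B : Module.Basis (Σ k, Fin (n k)) R⸨X⸩ E) (c : κ → R) (p : κ → R⸨X⸩)
    (M : ∀ k, Matrix (Fin (n k)) (Fin (n k)) R⸨X⸩) : Prop where
  jordan : ∀ k, IsJordanFlat (HahnSeries.C (c k) + p k) (M k)
  matrix : HasBlockMatrix D.toLinearMap B M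
  polar : ∀ k, p k ∈ polar R
  diag : ∀ x, P (B x) = p x.1 • B x

/-- `B x` lies in the span of the generalized kernel for its character, hence in the span of those
`B' y` with the same character. These have the same polar part `p x.1`, so `P'` acts on `B x` by the
same scalar as `P`. -/
theorem IsAdapted.unique [IsDomain R] (hR : ∀ n : ℕ, n ≠ 0 → IsUnit (n : R))
    [Fintype κ] {κ' : Type*} [Fintype κ'] {n' : κ' → ℕ} {D : Connection R E}
    {P P' : Module.End R⸨X⸩ E}
    {B : Module.Basis (Σ k, Fin (n k)) R⸨X⸩ E} {c : κ → R} {p : κ → R⸨X⸩}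
    {M : ∀ k, Matrix (Fin (n k)) (Fin (n k)) R⸨X⸩}
    {B' : Module.Basis (Σ k, Fin (n' k)) R⸨X⸩ E} {c' : κ' → R} {p' : κ' → R⸨X⸩}
    {M' : ∀ k, Matrix (Fin (n' k)) (Fin (n' k)) R⸨X⸩}
    (h : IsAdapted D P B c p M) (h' : IsAdapted D P' B' c' p' M') : P = P' := by
  refine B.ext fun x => ?_
  obtain ⟨q, h₁, h₂⟩ := ((eventually_span_ker_shift_pow D hR B h.jordan h.matrix
    (HahnSeries.C (c x.1) + p x.1)).and (eventually_span_ker_shift_pow D hR B' h'.jordan h'.matrix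
    (HahnSeries.C (c x.1) + p x.1))).exists
  have hx : B x ∈ Submodule.span R⸨X⸩ (B '' {y | (QuotientAddGroup.mk (HahnSeries.C (c y.1) + p y.1)
      : Character R) = QuotientAddGroup.mk (HahnSeries.C (c x.1) + p x.1)}) :=
    Submodule.subset_span ⟨x, rfl, rfl⟩
  rw [← h₁, h₂] at hx
  have hle : Submodule.span R⸨X⸩ (B' '' {y | (QuotientAddGroup.mk (HahnSeries.C (c' y.1) + p' y.1)
      : Character R) = QuotientAddGroup.mk (HahnSeries.C (c x.1) + p x.1)}) ≤
      LinearMap.ker (P' - p x.1 • LinearMap.id) := by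
    rw [Submodule.span_le]
    rintro _ ⟨y, hy, rfl⟩
    have hp := polar_eq_of_mk_eq (h'.polar _) (h.polar _) hy
    simp [h'.diag, hp]
  have := hle hx
  rw [LinearMap.mem_ker, LinearMap.sub_apply, sub_eq_zero] at this
  rw [this, h.diag]
  rfl

end Blocks

/-! ### Concatenating blocks into one matrix indexed by `Fin`. -/

section BlockDiag

variable {A : Type*} [CommRing A]

theorem IsJordanFlat.add_smul_one {m : ℕ} {f : A} {M : Matrix (Fin m) (Fin m) A}
    (hM : IsJordanFlat f M) (a : A) : IsJordanFlat (f + a) (M + a • 1) := by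
  refine ⟨fun i => by simp [hM.1 i], fun i j hij => ?_, fun i j hij hij' => ?_⟩
  · have hne : i ≠ j := fun h => by subst h; omega
    simpa [Matrix.one_apply_ne hne] using hM.2.1 i j hij
  · simpa [Matrix.one_apply_ne hij] using hM.2.2 i j hij hij'

theorem blockDiag_apply_same {l : ℕ} {r : Fin l → ℕ}
    (M : ∀ k, Matrix (Fin (r k)) (Fin (r k)) A) (k : Fin l) (i j : Fin (r k)) :
    blockDiag M (finSigmaFinEquiv ⟨k, i⟩) (finSigmaFinEquiv ⟨k, j⟩) = M k i j := by
  simp [blockDiag]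

theorem blockDiag_apply_ne {l : ℕ} {r : Fin l → ℕ}
    (M : ∀ k, Matrix (Fin (r k)) (Fin (r k)) A) {k k' : Fin l} (h : k ≠ k')
    (i : Fin (r k)) (j : Fin (r k')) :
    blockDiag M (finSigmaFinEquiv ⟨k, i⟩) (finSigmaFinEquiv ⟨k', j⟩) = 0 := by
  simp [blockDiag, Matrix.blockDiagonal'_apply_ne _ _ _ h]

/-- Where two blocks meet, the subdiagonal entry is `0`, which the definition permits; unequal
subdiagonal entries are allowed for exactly this use. -/
theorem IsJordanFlat.blockDiag {l : ℕ} {r : Fin l → ℕ} {f : A}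
    {M : ∀ k, Matrix (Fin (r k)) (Fin (r k)) A} (hM : ∀ k, IsJordanFlat f (M k)) :
    IsJordanFlat f (blockDiag M) := by
  refine ⟨fun i => ?_, fun i j => ?_, fun i j => ?_⟩
  · obtain ⟨⟨k, i⟩, rfl⟩ := finSigmaFinEquiv.surjective i
    rw [blockDiag_apply_same, (hM k).1]
  · obtain ⟨⟨k, i⟩, rfl⟩ := finSigmaFinEquiv.surjective i
    obtain ⟨⟨k', j⟩, rfl⟩ := finSigmaFinEquiv.surjective j
    intro h
    rcases eq_or_ne k k' with rfl | hk
    · rw [blockDiag_apply_same]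
      refine (hM k).2.1 i j ?_
      rw [finSigmaFinEquiv_apply, finSigmaFinEquiv_apply] at h
      dsimp only at h
      omega
    · exact Or.inl (blockDiag_apply_ne M hk i j)
  · obtain ⟨⟨k, i⟩, rfl⟩ := finSigmaFinEquiv.surjective i
    obtain ⟨⟨k', j⟩, rfl⟩ := finSigmaFinEquiv.surjective j
    intro h h'
    rcases eq_or_ne k k' with rfl | hk
    · rw [blockDiag_apply_same]
      refine (hM k).2.2 i j (fun hij => h (by rw [hij])) fun hij => h' ?_
      rw [finSigmaFinEquiv_apply, finSigmaFinEquiv_apply]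
      dsimp only
      omega
    · exact blockDiag_apply_ne M hk i j

variable {R : Type u} [CommRing R]
variable {E : Type v} [AddCommGroup E] [Module R⸨X⸩ E]

theorem hasMatrix_blockDiag_iff {l : ℕ} {r : Fin l → ℕ} {T : E → E} {b : Fin (∑ k, r k) → E}
    {M : ∀ k, Matrix (Fin (r k)) (Fin (r k)) R⸨X⸩} :
    HasMatrix T b (blockDiag M) ↔ HasBlockMatrix T (fun x => b (finSigmaFinEquiv x)) M := by
  have key : ∀ k (i : Fin (r k)), ∑ j, blockDiag M j (finSigmaFinEquiv ⟨k, i⟩) • b j =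
      ∑ j, M k j i • b (finSigmaFinEquiv ⟨k, j⟩) := fun k i => by
    rw [← finSigmaFinEquiv.sum_comp, Fintype.sum_sigma, Finset.sum_eq_single k]
    · exact Finset.sum_congr rfl fun j _ => by rw [blockDiag_apply_same]
    · intro k' _ hk
      exact Finset.sum_eq_zero fun j _ => by rw [blockDiag_apply_ne M hk, zero_smul]
    · simp
  constructor
  · intro h k i
    rw [h, key]
  · intro h j
    obtain ⟨⟨k, i⟩, rfl⟩ := finSigmaFinEquiv.surjective j
    rw [key]
    exact h k i

theorem hasBlockMatrix_collectedBasis {D : E → E}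
    {ι : Type*} [DecidableEq ι] {W : ι → Submodule R⸨X⸩ E} (hW : DirectSum.IsInternal W)
    {n : ι → ℕ} (b : ∀ i, Module.Basis (Fin (n i)) R⸨X⸩ (W i))
    {M : ∀ i, Matrix (Fin (n i)) (Fin (n i)) R⸨X⸩}
    (h : ∀ i, HasMatrix D (fun j => (b i j : E)) (M i)) :
    HasBlockMatrix D (hW.collectedBasis b) M := by
  intro k i
  simp only [DirectSum.IsInternal.collectedBasis_coe]
  exact h k i

theorem exists_basis_coe_eq {K V ι : Type*} [Ring K] [AddCommGroup V] [Module K V] {f : ι → V}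
    (hf : LinearIndependent K f) {W : Submodule K V} (hW : Submodule.span K (Set.range f) = W) :
    ∃ b : Module.Basis ι K W, ∀ i, (b i : V) = f i := by
  subst hW
  exact ⟨Module.Basis.span hf, fun i => congrArg Subtype.val (Module.Basis.span_apply hf i)⟩

end BlockDiag

/-! ### Logarithmic lattices and regular singularity. -/

section RegularSingular

variable {R : Type u} [CommRing R]

theorem thetaPow_add (f g : R⟦X⟧) : thetaPow R (f + g) = thetaPow R f + thetaPow R g :=
  HahnSeries.ofPowerSeries_injective (Γ := ℤ) (by
    simp only [← theta_ofPowerSeries, map_add, theta_add])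

theorem thetaPow_mul (f g : R⟦X⟧) :
    thetaPow R (f * g) = thetaPow R f * g + f * thetaPow R g :=
  HahnSeries.ofPowerSeries_injective (Γ := ℤ) (by
    simp only [← theta_ofPowerSeries, map_add, map_mul, theta_mul])

theorem thetaPow_zero : thetaPow R 0 = 0 := by
  ext n; simp [thetaPow]

theorem thetaPow_one : thetaPow R 1 = 0 :=
  HahnSeries.ofPowerSeries_injective (Γ := ℤ) (by
    rw [← theta_ofPowerSeries, map_one, map_zero, theta_one])

variable {E : Type v} [AddCommGroup E] [Module R E] [Module R⸨X⸩ E]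

/-- The logarithmic connection with matrix `A` in the basis `b`. -/
def logConnection {ι L : Type*} [Fintype ι] [AddCommGroup L] [Module R⟦X⟧ L]
    (b : Module.Basis ι R⟦X⟧ L) (A : Matrix ι ι R⟦X⟧) : L →+ L :=
  AddMonoidHom.mk' (fun m => ∑ i, (thetaPow R (b.repr m i) • b i +
    b.repr m i • ∑ j, A j i • b j)) fun m m' => by
      simp only [map_add, Finsupp.add_apply, thetaPow_add, add_smul, ← Finset.sum_add_distrib]
      exact Finset.sum_congr rfl fun i _ => by abel

theorem logConnection_apply {ι L : Type*} [Fintype ι] [AddCommGroup L] [Module R⟦X⟧ L]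
    (b : Module.Basis ι R⟦X⟧ L) (A : Matrix ι ι R⟦X⟧) (m : L) :
    logConnection b A m = ∑ i, (thetaPow R (b.repr m i) • b i +
      b.repr m i • ∑ j, A j i • b j) := rfl

theorem logConnection_smul {ι L : Type*} [Fintype ι] [AddCommGroup L] [Module R⟦X⟧ L]
    (b : Module.Basis ι R⟦X⟧ L) (A : Matrix ι ι R⟦X⟧) (f : R⟦X⟧) (m : L) :
    logConnection b A (f • m) = thetaPow R f • m + f • logConnection b A m := by
  have h : thetaPow R f • m = ∑ i, thetaPow R f • b.repr m i • b i := by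
    rw [← Finset.smul_sum, b.sum_repr]
  rw [logConnection_apply, logConnection_apply, h, Finset.smul_sum, ← Finset.sum_add_distrib]
  refine Finset.sum_congr rfl fun i _ => ?_
  rw [map_smul, Finsupp.smul_apply, smul_eq_mul, thetaPow_mul, add_smul, smul_add, mul_smul,
    mul_smul, mul_smul, add_assoc]

theorem logConnection_basis {ι L : Type*} [Fintype ι] [AddCommGroup L] [Module R⟦X⟧ L]
    (b : Module.Basis ι R⟦X⟧ L) (A : Matrix ι ι R⟦X⟧) (i : ι) :
    logConnection b A (b i) = ∑ j, A j i • b j := by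
  classical
  rw [logConnection_apply, Finset.sum_eq_single i]
  · rw [b.repr_self, Finsupp.single_eq_same, thetaPow_one, zero_smul, zero_add, one_smul]
  · intro j _ hj
    rw [b.repr_self, Finsupp.single_eq_of_ne hj, thetaPow_zero, zero_smul, zero_smul, add_zero]
  · simp

/-- A connection whose matrix in some basis has entries in `R[[x]]` is regular singular. -/
theorem Connection.isRegularSingular_of_matrix (D : Connection R E) {ι : Type*} [Fintype ι]
    (b : Module.Basis ι R⸨X⸩ E) (A : Matrix ι ι R⟦X⟧)
    (hA : ∀ i, D.toLinearMap (b i) = ∑ j, HahnSeries.ofPowerSeries ℤ R (A j i) • b j) :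
    D.IsRegularSingular := by
  -- The lattice must live in the universe of `E`; the coordinates in `b` embed `R[[x]]^ι` into `E`,
  -- so it can be shrunk there.
  have hsmall : Small.{v} (ι → R⟦X⟧) := by
    refine small_of_injective (β := E)
      (f := fun f => b.equivFun.symm fun i => HahnSeries.ofPowerSeries ℤ R (f i)) ?_
    intro f g hfg
    funext i
    exact HahnSeries.ofPowerSeries_injective (congrFun (b.equivFun.symm.injective hfg) i)
  let L := Shrink.{v} (ι → R⟦X⟧)
  let bL : Module.Basis ι R⟦X⟧ L :=
    (Pi.basisFun R⟦X⟧ ι).map (Shrink.linearEquiv R⟦X⟧ (ι → R⟦X⟧)).symm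
  let iso : (R⸨X⸩ ⊗[R⟦X⟧] L) ≃ₗ[R⸨X⸩] E := (bL.baseChange R⸨X⸩).equiv b (Equiv.refl ι)
  have hsmul : ∀ (f : R⸨X⸩) (g : R⟦X⟧) (m : L), iso (f ⊗ₜ[R⟦X⟧] (g • m)) =
      iso ((f * HahnSeries.ofPowerSeries ℤ R g) ⊗ₜ[R⟦X⟧] m) := fun f g m => by
    rw [← TensorProduct.smul_tmul, Algebra.smul_def, LaurentSeries.coe_algebraMap, mul_comm]
  have hiso : ∀ (f : R⸨X⸩) (i : ι), iso (f ⊗ₜ[R⟦X⟧] bL i) = f • b i := fun f i => by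
    have h1 : iso ((bL.baseChange R⸨X⸩) i) = b i := by
      rw [Module.Basis.equiv_apply]; rfl
    rw [← h1, ← map_smul, Module.Basis.baseChange_apply, TensorProduct.smul_tmul', smul_eq_mul,
      mul_one]
  refine ⟨L, inferInstance, inferInstance, Module.Finite.of_basis bL, logConnection bL A, iso,
    logConnection_smul bL A, fun f m => ?_⟩
  rw [← bL.sum_repr m]
  refine Finset.sum_induction (fun i => bL.repr m i • bL i)
    (fun m => ∀ f : R⸨X⸩, D.toLinearMap (iso (f ⊗ₜ[R⟦X⟧] m)) =
      iso (theta R f ⊗ₜ[R⟦X⟧] m + f ⊗ₜ[R⟦X⟧] logConnection bL A m)) ?_ ?_ ?_ f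
  · intro m m' hm hm' f
    rw [TensorProduct.tmul_add, map_add, map_add, hm, hm', ← map_add, map_add (logConnection bL A),
      TensorProduct.tmul_add, TensorProduct.tmul_add]
    congr 1
    abel
  · intro f
    simp
  · intro i _ f
    have h : ∀ f : R⸨X⸩, D.toLinearMap (iso (f ⊗ₜ[R⟦X⟧] bL i)) =
        iso (theta R f ⊗ₜ[R⟦X⟧] bL i) + iso (f ⊗ₜ[R⟦X⟧] logConnection bL A (bL i)) := fun f => by
      rw [logConnection_basis, hiso, hiso, D.leibniz, hA, TensorProduct.tmul_sum, map_sum,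
        Finset.smul_sum]
      congr 1
      refine Finset.sum_congr rfl fun j _ => ?_
      rw [hsmul, hiso, mul_smul]
    rw [hsmul, h, logConnection_smul, TensorProduct.tmul_add, map_add, map_add, hsmul, hsmul, hsmul,
      theta_mul, theta_ofPowerSeries, TensorProduct.add_tmul, map_add, add_assoc]

end RegularSingular

/-! ### Adapted bases, and existence and uniqueness of the decomposition. -/

section Decomposition

variable {R : Type u} [CommRing R]
variable {E : Type v} [AddCommGroup E] [Module R E] [Module R⸨X⸩ E]

variable {κ : Type w} {n : κ → ℕ}

/-- Rescaling a basis of Jordan blocks by units changes the diagonals by elements of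
`ℤ + x R[[x]]`. -/
theorem HasBlockMatrix.exists_rescale (hR : ∀ n : ℕ, n ≠ 0 → IsUnit (n : R))
    {D : Connection R E} {B : Module.Basis (Σ k, Fin (n k)) R⸨X⸩ E}
    {M : ∀ k, Matrix (Fin (n k)) (Fin (n k)) R⸨X⸩} (hB : HasBlockMatrix D.toLinearMap B M)
    {a : κ → R⸨X⸩} (ha : ∀ k, a k ∈ dLog R) :
    ∃ B' : Module.Basis (Σ k, Fin (n k)) R⸨X⸩ E,
      HasBlockMatrix D.toLinearMap B' fun k => M k + a k • 1 := by
  choose u hu using fun k => exists_unit_theta_eq hR (ha k)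
  refine ⟨B.unitsSMul fun x => u x.1, fun k i => ?_⟩
  simp only [Module.Basis.unitsSMul_apply, Matrix.add_apply, add_smul, Finset.sum_add_distrib,
    Units.smul_def, D.leibniz, hu, hB k i, Finset.smul_sum]
  rw [add_comm]
  congr 1
  · exact Finset.sum_congr rfl fun j _ => smul_comm _ _ _
  · rw [Finset.sum_eq_single i]
    · simp [mul_smul]
    · intro j _ hj
      simp [Matrix.one_apply_ne hj]
    · simp

section Adapted

variable {D : Connection R E} {P : Module.End R⸨X⸩ E}
  {B : Module.Basis (Σ k, Fin (n k)) R⸨X⸩ E} {c : κ → R} {p : κ → R⸨X⸩}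
  {M : ∀ k, Matrix (Fin (n k)) (Fin (n k)) R⸨X⸩}

theorem IsAdapted.hasBlockMatrix_end (h : IsAdapted D P B c p M) :
    HasBlockMatrix P B fun k =>
      p k • (1 : Matrix (Fin (n k)) (Fin (n k)) R⸨X⸩) := by
  intro k i
  rw [h.diag, Finset.sum_eq_single i]
  · simp
  · intro j _ hj
    simp [Matrix.one_apply_ne hj]
  · simp

theorem IsAdapted.jordan_subEnd (h : IsAdapted D P B c p M) (k : κ) :
    IsJordanFlat (HahnSeries.C (c k)) (M k + -p k • 1) := by
  simpa using (h.jordan k).add_smul_one (-p k)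

theorem IsAdapted.isDiagonalizable [Finite κ] (h : IsAdapted D P B c p M) :
    IsDiagonalizable P := by
  have := Fintype.ofFinite κ
  let e := Fintype.equivFin (Σ k, Fin (n k))
  refine ⟨_, B.reindex e, fun i => p (e.symm i).1, fun i => ?_⟩
  rw [B.reindex_apply, h.diag]

theorem IsAdapted.eigenvalue_mem_polar [IsDomain R] (h : IsAdapted D P B c p M)
    {μ : R⸨X⸩} (hμ : P.HasEigenvalue μ) : μ ∈ LogDecomp.polar R := by
  obtain ⟨v, hv⟩ := hμ.exists_hasEigenvector
  have hne : B.repr v ≠ 0 := fun h0 => hv.2 (B.repr.map_eq_zero_iff.1 h0)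
  obtain ⟨x, hx⟩ := Finsupp.ne_iff.1 hne
  -- The coordinate functional is an eigenvector of the transpose of `P`. Evaluated at an
  -- eigenvector with nonzero `x`-coordinate, this forces `μ = p x.1`.
  have hcoord : B.coord x ∘ₗ P = p x.1 • B.coord x := by
    refine B.ext fun y => ?_
    rw [LinearMap.comp_apply, h.diag, map_smul, LinearMap.smul_apply, B.coord_apply,
      B.repr_self]
    rcases eq_or_ne x y with rfl | hxy
    · rfl
    · rw [Finsupp.single_eq_of_ne hxy, smul_zero, smul_zero]
  have := LinearMap.congr_fun hcoord v
  rw [LinearMap.comp_apply, hv.apply_eq_smul, map_smul, LinearMap.smul_apply, B.coord_apply,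
    smul_eq_mul, smul_eq_mul] at this
  rw [mul_right_cancel₀ hx this]
  exact h.polar _

variable [IsScalarTower R R⸨X⸩ E]

/-- The connection `∇ - P`. -/
def Connection.subEnd (D : Connection R E) (P : Module.End R⸨X⸩ E) : Connection R E where
  toLinearMap := D.toLinearMap - P.restrictScalars R
  leibniz f e := by
    simp only [LinearMap.sub_apply, LinearMap.restrictScalars_apply, D.leibniz, map_smul, smul_sub]
    abel

theorem Connection.subEnd_apply (D : Connection R E) (P : Module.End R⸨X⸩ E) (e : E) :
    (D.subEnd P).toLinearMap e = D.toLinearMap e - P e := rfl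

theorem IsAdapted.hasBlockMatrix_subEnd (h : IsAdapted D P B c p M) :
    HasBlockMatrix (D.subEnd P).toLinearMap B fun k => M k + -p k • 1 := by
  intro k i
  rw [D.subEnd_apply, h.matrix, h.hasBlockMatrix_end, ← Finset.sum_sub_distrib]
  exact Finset.sum_congr rfl fun j _ => by
    dsimp only
    rw [Matrix.add_apply, neg_smul, Matrix.neg_apply, add_smul, neg_smul, sub_eq_add_neg]

/-- With the polar parts removed, all matrix entries are `c k`, `0` or `1`, so they lie in `R[[x]]`.
-/
theorem IsAdapted.isRegularSingular_subEnd [Fintype κ] (h : IsAdapted D P B c p M) :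
    (D.subEnd P).IsRegularSingular := by
  classical
  have hconst : ∀ k i j, ∃ a : R⟦X⟧,
      HahnSeries.ofPowerSeries ℤ R a = (M k + -p k • 1) i j := fun k i j => by
    obtain ⟨h₁, h₂, h₃⟩ := h.jordan_subEnd k
    rcases eq_or_ne i j with rfl | hij
    · exact ⟨PowerSeries.C (c k), by rw [h₁, HahnSeries.ofPowerSeries_C]⟩
    · by_cases hij' : (i : ℕ) = j + 1
      · rcases h₂ i j hij' with h | h
        · exact ⟨0, by rw [h, map_zero]⟩
        · exact ⟨1, by rw [h, map_one]⟩
      · exact ⟨0, by rw [h₃ i j hij hij', map_zero]⟩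
  choose a ha using hconst
  refine Connection.isRegularSingular_of_matrix _ B (Matrix.blockDiagonal' fun k => Matrix.of (a k))
    ?_
  rintro ⟨k, i⟩
  rw [h.hasBlockMatrix_subEnd, Fintype.sum_sigma, Finset.sum_eq_single k]
  · exact Finset.sum_congr rfl fun j _ => by simp [ha]
  · intro k' _ hk
    exact Finset.sum_eq_zero fun j _ => by
      rw [Matrix.blockDiagonal'_apply_ne _ _ _ hk, map_zero, zero_smul]
  · simp

/-- The part of the adapted basis lying over `s` serves for all three matrices at once. The
constants must be equal, not merely congruent modulo `ℤ`, for the blocks of `∇ - P` to merge into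
one `J♭`. -/
theorem IsAdapted.compatibleForm [Finite κ] (h : IsAdapted D P B c p M) (hn : ∀ k, 0 < n k)
    (s : Set κ) (c₀ : R) (hc : ∀ k ∈ s, c k = c₀) :
    CompatibleForm D (D.subEnd P) P (QuotientAddGroup.mk (HahnSeries.C c₀))
      (Submodule.span R⸨X⸩ (B '' {x | x.1 ∈ s})) := by
  constructor
  · intro e he
    induction he using Submodule.span_induction with
    | mem e he =>
      obtain ⟨x, hx, rfl⟩ := he
      rw [h.diag]
      exact Submodule.smul_mem _ _ (Submodule.subset_span ⟨x, hx, rfl⟩)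
    | zero => rw [map_zero]; exact zero_mem _
    | add a b _ _ ha hb => rw [map_add]; exact add_mem ha hb
    | smul a b _ hb => rw [map_smul]; exact Submodule.smul_mem _ _ hb
  · let e := (Finite.equivFin s).symm
    let r : Fin (Nat.card s) → ℕ := fun k => n (e k)
    let v : (Σ k, Fin (r k)) → E := fun x => B ⟨e x.1, x.2⟩
    have hinj : Function.Injective fun x : Σ k, Fin (r k) => (⟨e x.1, x.2⟩ : Σ k, Fin (n k)) := by
      rintro ⟨k, i⟩ ⟨k', i'⟩ hx
      obtain ⟨hk, hi⟩ := Sigma.mk.inj hx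
      obtain rfl : k = k' := e.injective (Subtype.ext hk)
      obtain rfl : i = i' := eq_of_heq hi
      rfl
    have hspan : Submodule.span R⸨X⸩ (Set.range v) =
        Submodule.span R⸨X⸩ (B '' {x | x.1 ∈ s}) := by
      congr 1
      apply Set.Subset.antisymm
      · rintro _ ⟨x, rfl⟩
        exact ⟨_, (e x.1).2, rfl⟩
      · rintro _ ⟨⟨k, i⟩, hk, rfl⟩
        obtain ⟨k', hk'⟩ := e.surjective ⟨k, hk⟩
        obtain rfl : (e k' : κ) = k := congrArg Subtype.val hk'
        exact ⟨⟨k', i⟩, rfl⟩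
    obtain ⟨b, hb⟩ := exists_basis_coe_eq (B.linearIndependent.comp _ hinj) hspan
    have hb' : (fun x => ((b.reindex finSigmaFinEquiv (finSigmaFinEquiv x) : _) : E)) = v := by
      funext x
      rw [b.reindex_apply, Equiv.symm_apply_apply]
      exact hb x
    refine ⟨c₀, Nat.card s, r, fun k => p (e k), b.reindex finSigmaFinEquiv,
      blockDiag fun k => M (e k) + -p (e k) • 1, fun k => M (e k), rfl, fun k => hn _,
      fun k => h.polar _, IsJordanFlat.blockDiag fun k => ?_, ?_, fun k => ?_, ?_, ?_⟩
    · rw [← hc _ (e k).2]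
      exact h.jordan_subEnd _
    · rw [hasMatrix_blockDiag_iff, hb']
      exact fun k i => h.hasBlockMatrix_subEnd _ _
    · rw [← hc _ (e k).2]
      exact h.jordan _
    · rw [hasMatrix_blockDiag_iff, hb']
      exact fun k i => h.matrix _ _
    · rw [hasMatrix_blockDiag_iff, hb']
      exact fun k i => h.hasBlockMatrix_end _ _

end Adapted

variable [IsScalarTower R R⸨X⸩ E]

theorem IsTLJDecomposition.isInternal {D : Connection R E} {Φ : Finset (Character R)}
    [DecidableEq Φ] {W : Φ → Submodule R⸨X⸩ E} (h : IsTLJDecomposition D Φ W) :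
    DirectSum.IsInternal W :=
  DirectSum.isInternal_submodule_of_iSupIndep_of_iSup_eq_top h.independent h.spanning

theorem Connection.AdmitsTLJForm.exists_basis {D : Connection R E} (hD : D.AdmitsTLJForm) :
    ∃ (κ : Type u) (_ : Fintype κ) (n : κ → ℕ) (B : Module.Basis (Σ k, Fin (n k)) R⸨X⸩ E)
      (g : κ → R⸨X⸩) (M : ∀ k, Matrix (Fin (n k)) (Fin (n k)) R⸨X⸩),
      (∀ k, 0 < n k) ∧ (∀ k, IsJordanFlat (g k) (M k)) ∧ HasBlockMatrix D.toLinearMap B M := by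
  classical
  obtain ⟨Φ, W, hW, h⟩ := hD
  choose g n b M hg hM hb using h
  refine ⟨Φ, inferInstance, n, hW.isInternal.collectedBasis b, g, M, fun φ => ?_, hM,
    hasBlockMatrix_collectedBasis _ b hb⟩
  -- A block of size `0` would make the component zero, which a TLJ-decomposition excludes.
  by_contra hn
  have hn : n φ = 0 := by omega
  have : IsEmpty (Fin (n φ)) := by rw [hn]; infer_instance
  have : Subsingleton (W φ) := (b φ).repr.injective.subsingleton
  exact hW.ne_bot φ (Submodule.eq_bot_of_subsingleton)

/-- The sums of the Jordan blocks with a given character form a TLJ-decomposition. -/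
theorem isTLJDecomposition_of_hasBlockMatrix [IsDomain R] [Fintype κ]
    (hR : ∀ n : ℕ, n ≠ 0 → IsUnit (n : R)) {D : Connection R E} (hn : ∀ k, 0 < n k)
    (B : Module.Basis (Σ k, Fin (n k)) R⸨X⸩ E) {g : κ → R⸨X⸩}
    {M : ∀ k, Matrix (Fin (n k)) (Fin (n k)) R⸨X⸩} (hM : ∀ k, IsJordanFlat (g k) (M k))
    (hB : HasBlockMatrix D.toLinearMap B M) (Φ : Finset (Character R))
    (hΦ : ∀ φ, φ ∈ Φ ↔ ∃ k, QuotientAddGroup.mk (g k) = φ) :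
    IsTLJDecomposition D Φ fun φ => Submodule.span R⸨X⸩
      (B '' {x | (QuotientAddGroup.mk (g x.1) : Character R) = φ}) where
  independent φ := by
    have hdisj := B.linearIndependent.disjoint_span_image
      (disjoint_compl_right (a := {x | (QuotientAddGroup.mk (g x.1) : Character R) = φ}))
    refine hdisj.mono_right (iSup_le fun ψ => iSup_le fun hψ => ?_)
    refine Submodule.span_mono (Set.image_mono ?_)
    intro x (hx : _ = _) (hx' : _ = _)
    exact hψ (Subtype.ext (hx.symm.trans hx'))
  spanning := by
    rw [eq_top_iff, ← B.span_eq, Submodule.span_le]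
    rintro _ ⟨x, rfl⟩
    have hx : B x ∈ Submodule.span R⸨X⸩ (B '' {y | (QuotientAddGroup.mk (g y.1) : Character R) =
      QuotientAddGroup.mk (g x.1)}) := Submodule.subset_span ⟨x, rfl, rfl⟩
    exact le_iSup (fun φ : Φ => Submodule.span R⸨X⸩
      (B '' {y | (QuotientAddGroup.mk (g y.1) : Character R) = φ}))
      ⟨QuotientAddGroup.mk (g x.1), (hΦ _).2 ⟨x.1, rfl⟩⟩ hx
  ne_bot φ := by
    obtain ⟨k, hk⟩ := (hΦ _).1 φ.2
    intro h
    refine B.ne_zero ⟨k, 0, hn k⟩ ((Submodule.mem_bot R⸨X⸩).1 ?_)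
    rw [← h]
    exact Submodule.subset_span ⟨⟨k, 0, hn k⟩, hk, rfl⟩
  stable φ e he := by
    induction he using Submodule.span_induction with
    | mem e he =>
      obtain ⟨⟨k, i⟩, hk, rfl⟩ := he
      rw [hB]
      exact sum_mem fun j _ => Submodule.smul_mem _ _ (Submodule.subset_span ⟨⟨k, j⟩, hk, rfl⟩)
    | zero => rw [map_zero]; exact zero_mem _
    | add a b _ _ ha hb => rw [map_add]; exact add_mem ha hb
    | smul a b hb ih =>
      rw [D.leibniz]
      exact add_mem (Submodule.smul_mem _ _ hb) (Submodule.smul_mem _ _ ih)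
  generated φ := by
    obtain ⟨k, hk⟩ := (hΦ _).1 φ.2
    refine ⟨g k, hk, (eventually_span_ker_shift_pow D hR B hM hB (g k)).mono fun q hq => ?_⟩
    rw [hq, hk]

theorem IsAdapted.isLogDecomposition [IsDomain R] [Fintype κ]
    (hR : ∀ n : ℕ, n ≠ 0 → IsUnit (n : R)) {D : Connection R E} {P : Module.End R⸨X⸩ E}
    {B : Module.Basis (Σ k, Fin (n k)) R⸨X⸩ E} {c : κ → R} {p : κ → R⸨X⸩}
    {M : ∀ k, Matrix (Fin (n k)) (Fin (n k)) R⸨X⸩} (h : IsAdapted D P B c p M)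
    (hn : ∀ k, 0 < n k)
    (hc : ∀ k k', (QuotientAddGroup.mk (HahnSeries.C (c k)) : Character R) =
      QuotientAddGroup.mk (HahnSeries.C (c k')) → c k = c k') :
    IsLogDecomposition D (D.subEnd P) P := by
  classical
  have hcompat : ∀ k, CompatibleForm D (D.subEnd P) P (QuotientAddGroup.mk (HahnSeries.C (c k)))
      (Submodule.span R⸨X⸩ (B '' {x | (QuotientAddGroup.mk (HahnSeries.C (c x.1)) :
        Character R) = QuotientAddGroup.mk (HahnSeries.C (c k))})) := fun k =>
    h.compatibleForm hn {k' | (QuotientAddGroup.mk (HahnSeries.C (c k')) : Character R) =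
      QuotientAddGroup.mk (HahnSeries.C (c k))} (c k) fun k' hk' => hc k' k hk'
  have hdec := isTLJDecomposition_of_hasBlockMatrix hR hn B h.jordan_subEnd
    h.hasBlockMatrix_subEnd (Finset.univ.image fun k => QuotientAddGroup.mk (HahnSeries.C (c k)))
    (by simp)
  refine ⟨fun e => ?_, h.isRegularSingular_subEnd, ⟨_, _, hdec, ?_⟩, h.isDiagonalizable,
    fun μ hμ => h.eigenvalue_mem_polar hμ, ?_⟩
  · rw [D.subEnd_apply, sub_add_cancel]
  · rintro ⟨φ, hφ⟩
    obtain ⟨k, -, rfl⟩ := Finset.mem_image.1 hφ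
    obtain ⟨-, c₀, l, r, f, b, J, M', hc₀, -, -, hJ, hb, -⟩ := hcompat k
    exact ⟨_, _, b, J, hc₀, hJ, hb⟩
  · rintro Sig W ⟨hW, -⟩ ϱ
    have hϱ := hW.eq_span hR B h.jordan_subEnd h.hasBlockMatrix_subEnd ϱ
    -- If no block had character `ϱ`, its component would be the span of the empty set.
    have hne : ∃ k, (QuotientAddGroup.mk (HahnSeries.C (c k)) : Character R) = ϱ := by
      by_contra! hne
      refine hW.ne_bot ϱ (hϱ.trans (Submodule.span_eq_bot.2 ?_))
      rintro _ ⟨x, hx, -⟩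
      exact absurd hx (hne x.1)
    obtain ⟨k, hk⟩ := hne
    rw [hϱ, ← hk]
    exact hcompat k

/-- Condition (iii), applied to one TLJ-form of `∇ʳˢ`, gives each component a basis in Jordan blocks
for `∇` on which `P` is scalar. The union of these bases is adapted, with blocks indexed by a
component and a block inside it. -/
theorem IsLogDecomposition.exists_isAdapted {D Drs : Connection R E} {P : Module.End R⸨X⸩ E}
    (h : IsLogDecomposition D Drs P) :
    ∃ (κ : Type u) (_ : Fintype κ) (n : κ → ℕ) (B : Module.Basis (Σ k, Fin (n k)) R⸨X⸩ E)
      (c : κ → R) (p : κ → R⸨X⸩) (M : ∀ k, Matrix (Fin (n k)) (Fin (n k)) R⸨X⸩),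
      IsAdapted D P B c p M := by
  classical
  obtain ⟨Sig, W, hW⟩ := h.admitsTLJForm
  choose c l r f b J M hc hr hf hJ hDrs hM hD hP using
    fun ϱ => (h.components Sig W hW ϱ).2
  let e : (Σ x : (Σ ϱ : Sig, Fin (l ϱ)), Fin (r x.1 x.2)) ≃ Σ ϱ : Sig, Fin (∑ k, r ϱ k) :=
    (Equiv.sigmaAssoc fun (ϱ : Sig) (k : Fin (l ϱ)) => Fin (r ϱ k)).trans
      (Equiv.sigmaCongrRight fun ϱ => finSigmaFinEquiv)
  let B := (hW.1.isInternal.collectedBasis b).reindex e.symm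
  have hBapply : ∀ ϱ k i, B ⟨⟨ϱ, k⟩, i⟩ = b ϱ (finSigmaFinEquiv ⟨k, i⟩) := fun ϱ k i => by
    rw [Module.Basis.reindex_apply, DirectSum.IsInternal.collectedBasis_coe]
    rfl
  refine ⟨Σ ϱ : Sig, Fin (l ϱ), inferInstance, fun x => r x.1 x.2, B, fun x => c x.1,
    fun x => f x.1 x.2, fun x => M x.1 x.2, fun x => hM _ _, ?_, fun x => hf _ _, ?_⟩
  · rintro ⟨ϱ, k⟩ i
    simp only [hBapply]
    exact hasMatrix_blockDiag_iff.1 (hD ϱ) k i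
  · rintro ⟨⟨ϱ, k⟩, i⟩
    simp only [hBapply]
    rw [hasMatrix_blockDiag_iff.1 (hP ϱ) k i, Finset.sum_eq_single i]
    · simp
    · intro j _ hj
      simp [Matrix.one_apply_ne hj]
    · simp

theorem existsUnique_isLogDecomposition [IsDomain R] (hR : ∀ n : ℕ, n ≠ 0 → IsUnit (n : R))
    (D : Connection R E) (hD : D.AdmitsTLJForm) :
    ∃! p : Connection R E × Module.End R⸨X⸩ E, IsLogDecomposition D p.1 p.2 := by
  obtain ⟨κ, _, n, B₀, g, M, hn, hM, hB₀⟩ := hD.exists_basis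
  obtain ⟨σ, hσ, hσ'⟩ := exists_constant_representatives R
  -- Passing through `σ` makes constants congruent modulo `ℤ` equal, as merging blocks requires.
  let c : κ → R := fun k => σ ((g k).coeff 0)
  let p : κ → R⸨X⸩ := fun k => polarPart (g k)
  -- The correction has two parts: the positive part of `g k`, and the integer by which `σ` moves
  -- its constant term.
  have hdLog : ∀ k, HahnSeries.C (c k) + p k - g k ∈ dLog R := fun k => by
    rw [← neg_sub, show g k - (HahnSeries.C (c k) + p k) =
      (g k - (HahnSeries.C ((g k).coeff 0) + p k)) +
        (HahnSeries.C ((g k).coeff 0) - HahnSeries.C (c k)) by abel]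
    exact neg_mem (add_mem (sub_C_add_polarPart_mem_dLog _) (mk_eq_mk_iff.1 (hσ _)))
  obtain ⟨B, hB⟩ := hB₀.exists_rescale hR hdLog
  have hadapted : IsAdapted D (B.constr R⸨X⸩ fun x => p x.1 • B x) B c p
      fun k => M k + (HahnSeries.C (c k) + p k - g k) • 1 :=
    ⟨fun k => by
      have := (hM k).add_smul_one (HahnSeries.C (c k) + p k - g k)
      rwa [add_sub_cancel] at this, hB,
      fun k => polarPart_mem_polar _, fun x => B.constr_basis _ _ _⟩
  refine ⟨⟨_, _⟩, hadapted.isLogDecomposition hR hn fun k k' h => hσ' _ _ h, ?_⟩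
  rintro ⟨Drs, P⟩ h
  obtain ⟨κ', _, n', B', c', p', M', h'⟩ := IsLogDecomposition.exists_isAdapted h
  obtain rfl : P = _ := h'.unique hR hadapted
  -- Once `P` is known, `∇ʳˢ` must be `∇ - P`.
  refine Prod.ext (Connection.ext' fun e => ?_) rfl
  exact (add_sub_cancel_right _ _).symm.trans (congrArg (· - _) (h.sum e).symm)

end Decomposition

end LogDecomp

end

theorem theorem4p10 {C : Type*} [Field C] [IsAlgClosed C] [CharZero C]
    {R : Type*} [CommRing R] [Algebra C R] (isoR : R ≃ₐ[C] PowerSeries C)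
    {E : Type*} [AddCommGroup E] [Module R E] [Module (LaurentSeries R) E]
    [IsScalarTower R (LaurentSeries R) E] [Module.Finite (LaurentSeries R) E]
    [Module.IsTorsionFree R E]
    (D : LogDecomp.Connection R E) (hD : D.AdmitsTLJForm) :
    ∃! p : LogDecomp.Connection R E × Module.End (LaurentSeries R) E,
      LogDecomp.IsLogDecomposition D p.1 p.2 := by
  have : IsDomain R := isoR.toMulEquiv.isDomain
  refine LogDecomp.existsUnique_isLogDecomposition (fun n hn => ?_) D hD
  rw [← map_natCast (algebraMap C R)]
  exact (Nat.cast_ne_zero.2 hn).isUnit.map (algebraMap C R)
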